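/- A group $G$ is LEF if for every finite subset $A\subseteq G$ there are a finite group $Q$ and an injective map $\phi:A\to Q$ with $\phi(gh)=\phi(g)\phi(h)$ whenever $g,h,gh\in A$. An action $\alpha$ of a group $\Gamma$ on a graph $X=(V,E)$ (simple, undirected) by graph automorphisms is a LEF action if for every finite $F\subseteq\Gamma$ and every finite induced subgraph $Z$ of $X$ there are a finite group $Q$, a finite graph $Y$, an action $\beta$ of $Q$ on $Y$ by graph automorphisms, a function $\rho:\Gamma\to Q$ and an embedding $\pi:Z\hookrightarrow Y$ as an induced subgraph, such that $\rho(gh)=\rho(g)\rho(h)$ whenever $g,h,gh\in F$, and $\pi(\alpha(g)\cdot x)=\beta(\rho(g))\cdot\pi(x)$ whenever $g\in F$ and $x$, $\alpha(g)\cdot x$ are vertices of $Z$. For a group $H$ and a graph $X=(V,E)$, let $$P(H,X)=\Big(\ast_{v\in V}H_v\Big)\Big/\big\langle\!\big\langle h^{-1}k^{-1}hk : (v,w)\in E,\ h\in H_v,\ k\in H_w\big\rangle\!\big\rangle$$ where each $H_v$ is a copy of $H$. An action $\alpha$ of $\Gamma$ on $X$ by graph automorphisms induces an action $\hat\alpha$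 of $\Gamma$ on $P(H,X)$ by automorphisms, $\hat\alpha(g)$ sending the copy $H_v$ identically onto $H_{\alpha(g)\cdot v}$; the graph wreath product is $\mathcal{W}(\Gamma,H,X)=P(H,X)\rtimes_{\hat\alpha}\Gamma$. **Theorem.** Let $\Gamma$ and $H$ be groups with $H$ nontrivial, and let $\Gamma$ act by graph automorphisms, via $\alpha$, on a graph $X$ with nonempty vertex set. Then $\mathcal{W}(\Gamma,H,X)$ is LEF if and only if $\Gamma$ and $H$ are LEF and $\alpha$ is a LEF action on the graph $X$. -/

import Mathlib

universe u v w

/-! ### LEF groups -/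

/-- `φ` is a partial homomorphism on the set `A`: only its values on `A` matter. -/
def IsPartialHomOn {G D : Type*} [Group G] [Group D] (A : Finset G) (φ : G → D) : Prop :=
  ∀ g ∈ A, ∀ h ∈ A, g * h ∈ A → φ (g * h) = φ g * φ h

/-- A group is LEF if every finite subset admits an injective partial homomorphism
to some finite group. (Every finite group has a copy in `Type`.) -/
def IsLEF (G : Type*) [Group G] : Prop :=
  ∀ A : Finset G, ∃ (Q : Type) (_ : Group Q) (_ : Finite Q) (φ : G → Q),
    IsPartialHomOn A φ ∧ Set.InjOn φ (A : Set G)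

/-! ### LEF actions on graphs -/

/-- An action `α` of `Γ` on the graph `X` by graph automorphisms is LEF if for all finite
`F ⊆ Γ` and all finite induced subgraphs (on a vertex set `Z`), there are a finite group `Q`
acting on a finite graph `Y` by graph automorphisms, a map `ρ : Γ → Q` that is a partial
homomorphism on `F`, and an embedding `π` of the subgraph induced on `Z` as an induced subgraph
of `Y`, which is equivariant wherever this makes sense. -/
def IsLEFGraphAction {Γ V : Type*} [Group Γ] {X : SimpleGraph V} (α : Γ →* (X ≃g X)) : Prop :=
  ∀ (F : Finset Γ) (Z : Finset V),
    ∃ (Q : Type) (_ : Group Q) (_ : Finite Q) (W : Type) (_ : Finite W) (Y : SimpleGraph W)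
      (β : Q →* (Y ≃g Y)) (ρ : Γ → Q) (π : X.induce (Z : Set V) ↪g Y),
      IsPartialHomOn F ρ ∧
      ∀ g ∈ F, ∀ (x : V) (hx : x ∈ Z) (hgx : α g x ∈ Z),
        π ⟨α g x, hgx⟩ = β (ρ g) (π ⟨x, hx⟩)

/-! ### Graph products -/

/-- The commutators `h⁻¹ k⁻¹ h k` in the free product of the `H v`, for `h ∈ H v`, `k ∈ H w`,
with `v` and `w` adjacent. -/
def graphProductRels {V : Type*} (H : V → Type*) [∀ v, Group (H v)] (X : SimpleGraph V) :
    Set (Monoid.CoprodI H) :=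
  {x | ∃ v w, X.Adj v w ∧ ∃ (h : H v) (k : H w),
    x = (Monoid.CoprodI.of h)⁻¹ * (Monoid.CoprodI.of k)⁻¹ *
      Monoid.CoprodI.of h * Monoid.CoprodI.of k}

/-- The graph product of the family `H` of groups over the graph `X`. -/
abbrev GraphProduct {V : Type*} (H : V → Type*) [∀ v, Group (H v)] (X : SimpleGraph V) : Type _ :=
  Monoid.CoprodI H ⧸ Subgroup.normalClosure (graphProductRels H X)

namespace GraphProduct

/-- The canonical map of a vertex group to the graph product. -/
def of {V : Type*} {H : V → Type*} [∀ v, Group (H v)] (X : SimpleGraph V) (v : V) :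
    H v →* GraphProduct H X :=
  (QuotientGroup.mk' _).comp Monoid.CoprodI.of

theorem of_commute {V : Type*} {H : V → Type*} [∀ v, Group (H v)] {X : SimpleGraph V} {v w : V}
    (hvw : X.Adj v w) (h : H v) (k : H w) : of X v h * of X w k = of X w k * of X v h := by
  have key : (of X v h)⁻¹ * (of X w k)⁻¹ * of X v h * of X w k = 1 :=
    (QuotientGroup.eq_one_iff _).2 (Subgroup.subset_normalClosure ⟨v, w, hvw, h, k, rfl⟩)
  have h2 : of X v h * of X w k =
      of X w k * of X v h * ((of X v h)⁻¹ * (of X w k)⁻¹ * of X v h * of X w k) := by group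
  rw [h2, key, mul_one]

theorem hom_ext {V : Type*} {H : V → Type*} [∀ v, Group (H v)] {X : SimpleGraph V}
    {M : Type*} [Monoid M] {f g : GraphProduct H X →* M}
    (hfg : ∀ v (h : H v), f (of X v h) = g (of X v h)) : f = g := by
  apply QuotientGroup.monoidHom_ext
  apply Monoid.CoprodI.ext_hom
  intro v
  ext h
  exact hfg v h

/-- The map of graph products of copies of a fixed group `H` that is induced by a map of graphs:
the copy of `H` at `v` is sent identically to the copy of `H` at `f v`. -/
def map (H : Type*) [Group H] {V V' : Type*} {X : SimpleGraph V} {Y : SimpleGraph V'}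
    (f : X →g Y) : GraphProduct (fun _ : V => H) X →* GraphProduct (fun _ : V' => H) Y :=
  QuotientGroup.lift _ (Monoid.CoprodI.lift fun v => of (H := fun _ : V' => H) Y (f v)) (by
    apply Subgroup.normalClosure_le_normal
    rintro _ ⟨v, w, hvw, h, k, rfl⟩
    simp only [SetLike.mem_coe, MonoidHom.mem_ker, map_mul, map_inv, Monoid.CoprodI.lift_of]
    rw [mul_assoc, of_commute (H := fun _ : V' => H) (f.map_adj hvw) h k]
    group)

@[simp]
theorem map_of (H : Type*) [Group H] {V V' : Type*} {X : SimpleGraph V} {Y : SimpleGraph V'}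
    (f : X →g Y) (v : V) (h : H) :
    map H f (of (H := fun _ : V => H) X v h) = of (H := fun _ : V' => H) Y (f v) h := by
  change (Monoid.CoprodI.lift fun v => of (H := fun _ : V' => H) Y (f v))
    (Monoid.CoprodI.of (M := fun _ : V => H) (i := v) h) = _
  rw [Monoid.CoprodI.lift_of]

/-- The action of the automorphism group of `X` on the graph product of copies of `H`,
by permuting the copies. -/
def autAction (H : Type*) [Group H] {V : Type*} (X : SimpleGraph V) :
    (X ≃g X) →* MulAut (GraphProduct (fun _ : V => H) X) where
  toFun f := MonoidHom.toMulEquiv (map H f.toHom) (map H f.symm.toHom)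
    (hom_ext fun v h => by simp) (hom_ext fun v h => by simp)
  map_one' := by
    ext x
    exact DFunLike.congr_fun (hom_ext (f := map H (1 : X ≃g X).toHom) (g := MonoidHom.id _)
      fun v h => by rw [map_of]; rfl) x
  map_mul' f g := by
    ext x
    exact DFunLike.congr_fun (hom_ext (f := map H (f * g).toHom)
      (g := (map H f.toHom).comp (map H g.toHom)) fun v h => by
        rw [MonoidHom.comp_apply, map_of, map_of, map_of]; rfl) x

theorem autAction_of (H : Type*) [Group H] {V : Type*} (X : SimpleGraph V) (f : X ≃g X)
    (v : V) (h : H) :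
    autAction H X f (of (H := fun _ : V => H) X v h) = of (H := fun _ : V => H) X (f v) h :=
  map_of H f.toHom v h

end GraphProduct

/-- The graph wreath product: the semidirect product of the graph product `P(H, X)` of copies of
`H` with `Γ`, with respect to the action of `Γ` that `α` induces by permuting the copies. -/
abbrev GraphWreathProduct {Γ : Type*} (H : Type*) [Group Γ] [Group H] {V : Type*}
    {X : SimpleGraph V} (α : Γ →* (X ≃g X)) : Type _ :=
  GraphProduct (fun _ : V => H) X ⋊[(GraphProduct.autAction H X).comp α] Γ

open Monoid GraphProduct
open scoped Pointwise

/-! ### LEF groups: permanence properties -/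

/-! Necessity: `Γ` and `H` embed in the wreath product. Fix `h ≠ 1` in `H`. Its copies at two
distinct vertices commute exactly when the vertices are adjacent, and `Γ` permutes these copies by
conjugation. So a finite approximation `Q` of the wreath product records both graph and action: take
the commuting graph of `Q`, with `Q` acting by conjugation (`IsLEF.isLEFGraphAction`).

Sufficiency: approximating the action by one on a finite graph `Y` approximates the wreath product
by an extension of the graph product over `Y` by a finite group
(`IsLEF.graphWreathProduct_of_exists`). It remains to see that graph products over finite graphs are
LEF (`IsLEF.graphProduct`). Delete a vertex `v`, let `G` be the graph product over the rest, and let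
`r : G →* G` be the retraction onto the part generated by the neighbours of `v`. The graph product
over `Y` embeds in a wreath product over the edgeless graph on `G`, where `g` acts by `x ↦ g * x *
(r g)⁻¹`. If `G` is LEF, two-sided multiplication on finite groups approximates this action. Since
the graphs are edgeless, only free products of copies of `H` need to be LEF (`IsLEF.coprodI`), so
the induction is not circular. -/

theorem IsLEF.of_exists {G : Type u} [Group G]
    (hG : ∀ A : Finset G, ∃ (K : Type v) (_ : Group K) (φ : G → K), IsLEF K ∧
      IsPartialHomOn A φ ∧ Set.InjOn φ (A : Set G)) : IsLEF G := by
  classical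
  intro A
  obtain ⟨K, _, φ, hK, hφ, hinj⟩ := hG A
  obtain ⟨Q, _, _, ψ, hψ, hψinj⟩ := hK (A.image φ)
  refine ⟨Q, inferInstance, inferInstance, ψ ∘ φ, fun g hg h hh hgh => ?_, ?_⟩
  · simp only [Function.comp_apply]
    rw [hφ g hg h hh hgh]
    refine hψ _ (Finset.mem_image_of_mem φ hg) _ (Finset.mem_image_of_mem φ hh) ?_
    rw [← hφ g hg h hh hgh]
    exact Finset.mem_image_of_mem φ hgh
  · exact hψinj.comp hinj fun g hg => Finset.mem_coe.2 (Finset.mem_image_of_mem φ hg)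

theorem IsLEF.of_finite (G : Type u) [Group G] [Finite G] : IsLEF G := by
  obtain ⟨Q, _, _, ⟨e⟩⟩ := Finite.exists_type_univ_nonempty_mulEquiv.{u, 0} G
  exact fun A => ⟨Q, inferInstance, Finite.of_fintype Q, e, fun g _ h _ _ => map_mul e g h,
    e.injective.injOn⟩

theorem IsLEF.of_injective {G : Type u} {K : Type v} [Group G] [Group K] (hK : IsLEF K)
    (f : G →* K) (hf : Function.Injective f) : IsLEF G :=
  IsLEF.of_exists fun _ => ⟨K, inferInstance, f, hK, fun g _ h _ _ => map_mul f g h, hf.injOn⟩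

/-- A map that is a partial homomorphism on a set containing `1` maps `1` to `1`. -/
theorem IsPartialHomOn.map_one {G : Type u} {K : Type v} [Group G] [Group K] {A : Finset G}
    {φ : G → K} (hφ : IsPartialHomOn A φ) (h1 : 1 ∈ A) : φ 1 = 1 := by
  have := hφ 1 h1 1 h1 (by simpa using h1)
  simpa using this

/-- An approximation `φ` of `N` need not respect the action of `Q`, so all its twists are recorded
at once: `n` goes to the function `r ↦ φ (θ r⁻¹ n)`, and `Q` translates the coordinates. The
coordinate at `1` recovers `φ n`. -/
theorem IsLEF.semidirectProduct {N : Type u} {Q : Type v} [Group N] [Group Q] [Finite Q]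
    (hN : IsLEF N) (θ : Q →* MulAut N) : IsLEF (N ⋊[θ] Q) := by
  classical
  have := Fintype.ofFinite Q
  refine IsLEF.of_exists.{max u v, v} fun A => ?_
  obtain ⟨K, _, _, φ, hφ, hinj⟩ := hN
    (A.biUnion fun a => Finset.univ.image fun q => θ q a.left)
  have hmem (a : N ⋊[θ] Q) (ha : a ∈ A) (q : Q) : θ q a.left ∈
      A.biUnion fun a => Finset.univ.image fun q => θ q a.left :=
    Finset.mem_biUnion.2 ⟨a, ha, Finset.mem_image_of_mem _ (Finset.mem_univ q)⟩
  let τ : Q →* MulAut (Q → K) :=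
    { toFun := fun q =>
        { toFun := fun f r => f (q⁻¹ * r)
          invFun := fun f r => f (q * r)
          left_inv := fun f => by simp
          right_inv := fun f => by simp
          map_mul' := fun f g => rfl }
      map_one' := by ext f r; simp
      map_mul' := fun q q' => by ext f r; simp [mul_assoc] }
  have : Finite ((Q → K) ⋊[τ] Q) := Finite.of_equiv _ SemidirectProduct.equivProd.symm
  refine ⟨(Q → K) ⋊[τ] Q, inferInstance, fun a => ⟨fun r => φ (θ r⁻¹ a.left), a.right⟩,
    IsLEF.of_finite _, fun a ha b hb hab => ?_, fun a ha b hb hab => ?_⟩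
  · refine SemidirectProduct.ext (funext fun r => ?_) rfl
    have h := hφ _ (hmem a ha r⁻¹) _ (hmem b hb (r⁻¹ * a.right))
    rw [map_mul, MulAut.mul_apply, ← map_mul] at h
    simpa [τ, -map_inv] using h (hmem (a * b) hab r⁻¹)
  · have h1 := congrFun (congrArg SemidirectProduct.left hab) 1
    have h2 := congrArg SemidirectProduct.right hab
    refine SemidirectProduct.ext (hinj ?_ ?_ ?_) h2
    · simpa using hmem a ha 1
    · simpa using hmem b hb 1
    · simpa using h1

/-! ### Free products of LEF groups -/

theorem List.eq_of_map_eq_map_of_injOn {α : Type u} {β : Type v} {f : α → β} {s : Set α}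
    (hf : Set.InjOn f s) {l l' : List α} (hl : ∀ a ∈ l, a ∈ s) (hl' : ∀ a ∈ l', a ∈ s)
    (h : l.map f = l'.map f) : l = l' := by
  induction l generalizing l' with
  | nil => exact (List.map_eq_nil_iff.1 h.symm).symm
  | cons a l ih =>
    cases l' with
    | nil => simp at h
    | cons b l' =>
      simp only [List.map_cons, List.cons.injEq, List.forall_mem_cons] at h hl hl'
      rw [hf hl.1 hl'.1 h.1, ih hl.2 hl'.2 h.2]

namespace Monoid.CoprodI.Word

variable {ι : Type u} [DecidableEq ι]

section

variable {M : ι → Type v} [∀ i, Monoid (M i)] [∀ i, DecidableEq (M i)]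

theorem head_equivPair_eq_one_or_mem (i : ι) (w : Word M) :
    (equivPair i w).head = 1 ∨ ⟨i, (equivPair i w).head⟩ ∈ w.toList := by
  by_cases h : (equivPair i w).head = 1
  · exact Or.inl h
  · right
    have := (mem_rcons_iff (equivPair i w) (equivPair i w).head).2 (Or.inr ⟨h, rfl, rfl⟩)
    rwa [← equivPair_symm, Equiv.symm_apply_apply] at this

omit [DecidableEq ι] in
theorem length_rcons_le {i : ι} (p : Pair M i) :
    (rcons p).toList.length ≤ p.tail.toList.length + 1 := by
  unfold rcons
  split_ifs <;> simp

end

section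

variable {M : ι → Type v} [∀ i, Group (M i)] [∀ i, DecidableEq (M i)]

/-- Left multiplication by elements of `M i` on reduced words, restricted to those words whose
orbit consists of words of length at most `n`; the other words are fixed. -/
def truncatedSMul (n : ℕ) (i : ι) (m : M i) (w : {w : Word M // w.toList.length ≤ n}) :
    {w : Word M // w.toList.length ≤ n} :=
  if h : (equivPair i w.1).tail.toList.length < n then
    ⟨of m • w.1, by
      rw [of_smul_def]
      exact (length_rcons_le _).trans h⟩
  else w

/-- The action of `M i` on reduced words of length at most `n` by `truncatedSMul`. -/
def truncatedPerm (n : ℕ) (i : ι) :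
    M i →* Equiv.Perm {w : Word M // w.toList.length ≤ n} :=
  letI : MulAction (M i) {w : Word M // w.toList.length ≤ n} :=
    { smul := truncatedSMul n i
      one_smul := fun w => by
        change truncatedSMul n i 1 w = w
        unfold truncatedSMul
        split_ifs
        · exact Subtype.ext (by simp)
        · rfl
      mul_smul := fun m m' w => by
        change truncatedSMul n i (m * m') w = truncatedSMul n i m (truncatedSMul n i m' w)
        unfold truncatedSMul
        by_cases h : (equivPair i w.1).tail.toList.length < n
        · have h' : (equivPair i (of m' • w.1)).tail.toList.length < n := by
            rwa [equivPair_smul_same]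
          simp only [dif_pos h, dif_pos h', map_mul, mul_smul]
        · simp only [dif_neg h] }
  MulAction.toPermHom _ _

theorem truncatedPerm_apply {n : ℕ} {i : ι} (m : M i) {w : {w : Word M // w.toList.length ≤ n}}
    (h : (equivPair i w.1).tail.toList.length < n) :
    (truncatedPerm n i m w).1 = of m • w.1 := by
  change (truncatedSMul n i m w).1 = _
  rw [truncatedSMul, dif_pos h]

/-- Building a reduced word of length at most `n` from its right end never meets the truncation.
Hence the permutation action separates such words; for finitely many finite factors it is an action
on a finite set. -/
theorem lift_truncatedPerm_apply_empty (n : ℕ) (w : Word M) (hw : w.toList.length ≤ n) :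
    (lift (truncatedPerm n) w.prod ⟨empty, Nat.zero_le n⟩).1 = w := by
  induction w using consRecOn with
  | empty => simp
  | cons i m w h1 h2 ih =>
    have hw' : w.toList.length + 1 ≤ n := by simpa using hw
    have ih := ih (by lia)
    rw [prod_cons, map_mul, lift_of, Equiv.Perm.mul_apply, truncatedPerm_apply, ih, cons_eq_smul]
    rw [ih, equivPair_eq_of_fstIdx_ne h1]
    exact hw'

end

section

variable {H : Type v} {K : Type w} [Group H] [Group K]

/-- Apply a map to all letters of a word, and multiply. -/
def mapProd (φ : H → K) (w : Word fun _ : ι => H) : CoprodI fun _ : ι => K :=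
  (w.toList.map fun l => of (M := fun _ : ι => K) (i := l.1) (φ l.2)).prod

variable [DecidableEq H]

omit [DecidableEq ι] in
theorem mapProd_rcons {φ : H → K} (h1 : φ 1 = 1) {i : ι} (p : Pair (fun _ : ι => H) i) :
    mapProd φ (rcons p) = of (M := fun _ : ι => K) (i := i) (φ p.head) * mapProd φ p.tail := by
  unfold rcons
  split_ifs with h
  · rw [h, h1, map_one, one_mul]
  · simp [mapProd]

/-- Only the head of the word at `i` changes, so a single instance of multiplicativity of `φ`
suffices. -/
theorem mapProd_of_smul {φ : H → K} {T : Finset H} (hφ : IsPartialHomOn T φ) (h1 : φ 1 = 1)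
    (i : ι) (h : H) (w : Word fun _ : ι => H) (hh : h ∈ T) (hhead : (equivPair i w).head ∈ T)
    (hmul : h * (equivPair i w).head ∈ T) :
    mapProd φ (of (M := fun _ : ι => H) (i := i) h • w) =
      of (M := fun _ : ι => K) (i := i) (φ h) * mapProd φ w := by
  rw [of_smul_def, mapProd_rcons h1]
  have hw : w = rcons (equivPair i w) := by rw [← equivPair_symm, Equiv.symm_apply_apply]
  conv_rhs => rw [hw, mapProd_rcons h1]
  rw [hφ _ hh _ hhead hmul, map_mul, mul_assoc]

/-- Each multiplication by a letter of `L` merges it with at most one existing letter, so the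
letters grow by at most one factor from `S` per step, and `φ` stays multiplicative throughout. -/
theorem mem_pow_and_mapProd_smul {φ : H → K} {S : Finset H} (h1S : 1 ∈ S) {N : ℕ}
    (hφ : IsPartialHomOn (S ^ (N + 1)) φ) (L : List (Σ _ : ι, H)) (hL : ∀ l ∈ L, l.2 ∈ S)
    (hN : L.length ≤ N) (w : Word fun _ : ι => H) (hw : ∀ l ∈ w.toList, l.2 ∈ S) :
    (∀ l ∈ ((L.map fun l => of (M := fun _ : ι => H) (i := l.1) l.2).prod • w).toList,
      l.2 ∈ S ^ (L.length + 1)) ∧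
    mapProd φ ((L.map fun l => of (M := fun _ : ι => H) (i := l.1) l.2).prod • w) =
      (L.map fun l => of (M := fun _ : ι => K) (i := l.1) (φ l.2)).prod * mapProd φ w := by
  have h1 : φ 1 = 1 := hφ.map_one (Finset.one_mem_pow h1S)
  induction L with
  | nil => simpa using hw
  | cons a L ih =>
    obtain ⟨i, h⟩ := a
    simp only [List.length_cons] at hN
    obtain ⟨ih1, ih2⟩ := ih (fun l hl => hL l (List.mem_cons_of_mem _ hl)) (by lia)
    simp only [List.map_cons, List.prod_cons, mul_smul, List.length_cons]
    generalize (L.map fun l => of (M := fun _ : ι => H) (i := l.1) l.2).prod • w = w' at ih1 ih2 ⊢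
    have hh : h ∈ S := hL _ List.mem_cons_self
    have hhead : (equivPair i w').head ∈ S ^ (L.length + 1) := by
      rcases head_equivPair_eq_one_or_mem i w' with he | he
      · rw [he]
        exact Finset.one_mem_pow h1S
      · exact ih1 _ he
    have hmul : h * (equivPair i w').head ∈ S ^ (L.length + 1 + 1) := by
      rw [pow_succ' S (L.length + 1)]
      exact Finset.mul_mem_mul hh hhead
    have hsub {k : ℕ} (hk : k ≤ N + 1) : S ^ k ⊆ S ^ (N + 1) :=
      Finset.pow_subset_pow_right h1S hk
    refine ⟨?_, ?_⟩
    · rintro ⟨j, x⟩ hx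
      rw [of_smul_def, mem_rcons_iff] at hx
      rcases hx with hx | ⟨_, rfl, rfl⟩
      · exact Finset.pow_subset_pow_right h1S (Nat.le_succ _)
          (ih1 _ (mem_of_mem_equivPair_tail _ hx))
      · exact hmul
    · rw [mapProd_of_smul hφ h1 i h w' ?_ (hsub (by lia) hhead) (hsub (by lia) hmul), ih2,
        mul_assoc]
      exact hsub (k := 1) (by lia) (by simpa using hh)

omit [DecidableEq H] in
-- Injectivity on `T` and `φ 1 = 1` keep nontrivial letters nontrivial, so the image word is already
-- reduced and normal forms can be compared.
theorem mapProd_injOn {φ : H → K} (h1 : φ 1 = 1) {T : Set H} (h1T : 1 ∈ T)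
    (hφ : Set.InjOn φ T) :
    Set.InjOn (mapProd (ι := ι) φ) {w | ∀ l ∈ w.toList, l.2 ∈ T} := by
  classical
  let F (w : Word fun _ : ι => H) (hw : ∀ l ∈ w.toList, l.2 ∈ T) : Word fun _ : ι => K :=
    { toList := w.toList.map fun l => ⟨l.1, φ l.2⟩
      ne_one := by
        intro l hl
        obtain ⟨l', hl', rfl⟩ := List.mem_map.1 hl
        exact fun h => w.ne_one l' hl' (hφ (hw l' hl') h1T (h.trans h1.symm))
      chain_ne := (List.isChain_map _).2 w.chain_ne }
  have hF w hw : (F w hw).prod = mapProd φ w := by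
    simp [F, Word.prod, mapProd, Function.comp_def]
  intro w hw w' hw' h
  rw [← hF w hw, ← hF w' hw'] at h
  have h2 := congrArg Word.toList (equiv.symm.injective h)
  refine Word.ext (List.eq_of_map_eq_map_of_injOn (s := {l : Σ _ : ι, H | l.2 ∈ T})
    ?_ hw hw' h2)
  rintro ⟨i, h⟩ hh ⟨j, k⟩ hk hhk
  obtain ⟨rfl, h3⟩ := Sigma.mk.inj_iff.1 hhk
  exact Sigma.ext rfl (heq_of_eq (hφ hh hk (eq_of_heq h3)))

end

end Monoid.CoprodI.Word

open Monoid.CoprodI in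
-- Applying an approximation `H → K` to the letters of normal forms reduces to finite `K`, where the
-- truncated actions on words give finite quotients.
theorem IsLEF.coprodI {ι : Type u} [Finite ι] {H : Type v} [Group H] (hH : IsLEF H) :
    IsLEF (CoprodI fun _ : ι => H) := by
  classical
  refine IsLEF.of_exists.{max u v, u} fun A => ?_
  let S : Finset H := insert 1
    (A.biUnion fun a => (Word.equiv a).toList.toFinset.image Sigma.snd)
  have h1S : 1 ∈ S := Finset.mem_insert_self _ _
  have hS : ∀ a ∈ A, ∀ l ∈ (Word.equiv a).toList, l.2 ∈ S := fun a ha l hl =>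
    Finset.mem_insert_of_mem (Finset.mem_biUnion.2
      ⟨a, ha, Finset.mem_image_of_mem _ (List.mem_toFinset.2 hl)⟩)
  let N : ℕ := A.sup fun a => (Word.equiv a).toList.length
  -- Exponent: up to `N` letters of the left factor may merge into one letter of the right factor.
  obtain ⟨K, _, _, φ, hφ, hinj⟩ := hH (S ^ (N + 1))
  have hSN : S ⊆ S ^ (N + 1) := by
    simpa using Finset.pow_subset_pow_right h1S (Nat.le_add_left 1 N)
  have h1 : φ 1 = 1 := hφ.map_one (hSN h1S)
  refine ⟨CoprodI fun _ : ι => K, inferInstance, fun a => Word.mapProd φ (Word.equiv a), ?_, ?_, ?_⟩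
  · refine IsLEF.of_exists.{u, u} fun B => ?_
    let n : ℕ := B.sup fun a => (Word.equiv a).toList.length
    have : Finite {w : Word fun _ : ι => K // w.toList.length ≤ n} := by
      have := (List.finite_length_le (Σ _ : ι, K) n).to_subtype
      exact Finite.of_injective
        (fun w => (⟨w.1.toList, w.2⟩ : ↥{l : List (Σ _ : ι, K) | l.length ≤ n}))
        fun w w' h => Subtype.ext (Word.ext (congrArg Subtype.val h))
    refine ⟨_, inferInstance, lift (Word.truncatedPerm n), IsLEF.of_finite _,
      fun g _ h _ _ => map_mul _ g h, fun a ha b hb hab => ?_⟩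
    have key (c) (hc : c ∈ B) :
        (lift (Word.truncatedPerm n) c ⟨Word.empty, Nat.zero_le n⟩).1 = Word.equiv c := by
      have := Word.lift_truncatedPerm_apply_empty n (Word.equiv c)
        (Finset.le_sup (f := fun a => (Word.equiv a).toList.length) hc)
      rwa [show (Word.equiv c).prod = c from Word.equiv.symm_apply_apply c] at this
    refine Word.equiv.injective ?_
    rw [← key a ha, ← key b hb, hab]
  · intro a ha b hb _
    have := (Word.mem_pow_and_mapProd_smul h1S hφ (Word.equiv a).toList (hS a ha)
      (Finset.le_sup (f := fun a => (Word.equiv a).toList.length) ha) (Word.equiv b) (hS b hb)).2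
    refine Eq.trans ?_ this
    rw [show ((Word.equiv a).toList.map fun l => of (M := fun _ : ι => H) (i := l.1) l.2).prod = a
      from Word.equiv.symm_apply_apply a]
    exact congrArg (Word.mapProd φ) (mul_smul a b (Word.empty : Word fun _ : ι => H))
  · exact (Word.mapProd_injOn h1 (hSN h1S) hinj).comp Word.equiv.injective.injOn
      fun a ha l hl => hSN (hS a ha l hl)

/-! ### Homomorphisms out of graph products -/

namespace GraphProduct

section

variable {V : Type*} {H : V → Type*} [∀ v, Group (H v)] {X : SimpleGraph V}

/-- The universal property of graph products. -/
def lift {M : Type*} [Group M] (f : ∀ v, H v →* M)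
    (hf : ∀ v w, X.Adj v w → ∀ h k, f v h * f w k = f w k * f v h) : GraphProduct H X →* M :=
  QuotientGroup.lift _ (Monoid.CoprodI.lift f) (by
    apply Subgroup.normalClosure_le_normal
    rintro _ ⟨v, w, hvw, h, k, rfl⟩
    simp only [SetLike.mem_coe, MonoidHom.mem_ker, map_mul, map_inv, Monoid.CoprodI.lift_of]
    rw [mul_assoc, hf v w hvw h k]
    group)

@[simp]
theorem lift_of {M : Type*} [Group M] (f : ∀ v, H v →* M)
    (hf : ∀ v w, X.Adj v w → ∀ h k, f v h * f w k = f w k * f v h) (v : V) (h : H v) :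
    lift f hf (of X v h) = f v h := by
  change Monoid.CoprodI.lift f (Monoid.CoprodI.of h) = _
  rw [Monoid.CoprodI.lift_of]

variable (H X) in
/-- The subgroup of the graph product generated by the vertex groups at the vertices in `Z`. -/
def supported (Z : Set V) : Subgroup (GraphProduct H X) :=
  Subgroup.closure {x | ∃ v ∈ Z, ∃ h, x = of X v h}

theorem of_mem_supported {Z : Set V} {v : V} (hv : v ∈ Z) (h : H v) :
    of X v h ∈ supported H X Z :=
  Subgroup.subset_closure ⟨v, hv, h, rfl⟩

theorem supported_mono {Z Z' : Set V} (hZ : Z ⊆ Z') : supported H X Z ≤ supported H X Z' :=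
  Subgroup.closure_mono fun _ ⟨v, hv, h, hx⟩ => ⟨v, hZ hv, h, hx⟩

theorem exists_finset_mem_supported (x : GraphProduct H X) :
    ∃ Z : Finset V, x ∈ supported H X (Z : Set V) := by
  classical
  obtain ⟨x, rfl⟩ := QuotientGroup.mk_surjective x
  induction x using Monoid.CoprodI.induction_on with
  | one => exact ⟨∅, one_mem _⟩
  | of v h => exact ⟨{v}, of_mem_supported (by simp) h⟩
  | mul x y hx hy =>
    obtain ⟨Z, hZ⟩ := hx
    obtain ⟨Z', hZ'⟩ := hy
    refine ⟨Z ∪ Z', mul_mem (supported_mono ?_ hZ) (supported_mono ?_ hZ')⟩ <;> simp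

theorem eq_of_mem_supported {M : Type*} [Group M] {f g : GraphProduct H X →* M} {Z : Set V}
    (hfg : ∀ v ∈ Z, ∀ h, f (of X v h) = g (of X v h)) {x : GraphProduct H X}
    (hx : x ∈ supported H X Z) : f x = g x := by
  refine MonoidHom.eqOn_closure (f := f) (g := g) ?_ hx
  rintro _ ⟨v, hv, h, rfl⟩
  exact hfg v hv h

end

section

variable (H : Type*) [Group H] {V : Type*} {X : SimpleGraph V}

/-- The homomorphism of graph products of copies of `H` induced by a partially defined map `f` of
vertices that preserves adjacency; the copies of `H` where `f` is undefined are killed. -/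
def partialMap {W : Type*} {Y : SimpleGraph W} (f : V → Option W)
    (hf : ∀ v v' w w', f v = some w → f v' = some w' → X.Adj v v' → Y.Adj w w') :
    GraphProduct (fun _ : V => H) X →* GraphProduct (fun _ : W => H) Y :=
  lift (fun v => (f v).elim 1 fun w => of (H := fun _ : W => H) Y w) (by
    intro v v' hvv' h k
    cases hv : f v with
    | none => simp
    | some w =>
      cases hv' : f v' with
      | none => simp
      | some w' => exact of_commute (H := fun _ : W => H) (hf v v' w w' hv hv' hvv') h k)

variable {H}

theorem partialMap_of_some {W : Type*} {Y : SimpleGraph W} {f : V → Option W}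
    (hf : ∀ v v' w w', f v = some w → f v' = some w' → X.Adj v v' → Y.Adj w w') {v : V} {w : W}
    (hv : f v = some w) (h : H) :
    partialMap H f hf (of (H := fun _ : V => H) X v h) = of (H := fun _ : W => H) Y w h := by
  rw [partialMap, lift_of, hv]
  rfl

variable (H X) in
/-- The projection of a graph product of copies of `H` to one of the copies. -/
def proj [DecidableEq V] (v : V) : GraphProduct (fun _ : V => H) X →* H :=
  lift (fun u => if u = v then MonoidHom.id H else 1) (by
    intro u w huw h k
    by_cases hu : u = v
    · have hw : w ≠ v := fun hw => huw.ne (hu.trans hw.symm)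
      simp [hw]
    · simp [hu])

theorem proj_of [DecidableEq V] (u v : V) (h : H) :
    proj H X v (of (H := fun _ : V => H) X u h) = if u = v then h else 1 := by
  rw [proj, lift_of]
  split_ifs <;> rfl

theorem of_injective (v : V) : Function.Injective (of (H := fun _ : V => H) X v) := by
  classical
  exact Function.LeftInverse.injective (g := proj H X v) fun h => by simp [proj_of]

theorem of_ne_of {v w : V} (hne : v ≠ w) {h : H} (hh : h ≠ 1) :
    of (H := fun _ : V => H) X v h ≠ of (H := fun _ : V => H) X w h := by
  classical
  intro heq
  have := congrArg (proj H X v) heq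
  rw [proj_of, proj_of, if_pos rfl, if_neg hne.symm] at this
  exact hh this

/-- Killing all other vertex groups maps to the free product of two copies of `H`, where the two
products are distinct reduced words. -/
theorem not_commute_of {v w : V} (hne : v ≠ w) (hvw : ¬ X.Adj v w) {h k : H} (hh : h ≠ 1)
    (hk : k ≠ 1) :
    of (H := fun _ : V => H) X v h * of (H := fun _ : V => H) X w k ≠
      of (H := fun _ : V => H) X w k * of (H := fun _ : V => H) X v h := by
  classical
  let f : GraphProduct (fun _ : V => H) X →* CoprodI (fun _ : Bool => H) :=
    lift (fun u => if u = v then CoprodI.of (M := fun _ : Bool => H) (i := true) else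
      if u = w then CoprodI.of (M := fun _ : Bool => H) (i := false) else 1) (by
      intro a b hab h k
      by_cases hav : a = v
      · have hbv : b ≠ v := fun hb => hab.ne (hav.trans hb.symm)
        have hbw : b ≠ w := by
          rintro rfl
          exact hvw (hav ▸ hab)
        simp [hbv, hbw]
      · by_cases haw : a = w
        · have hbw : b ≠ w := fun hb => hab.ne (haw.trans hb.symm)
          have hbv : b ≠ v := by
            rintro rfl
            exact hvw (haw ▸ hab.symm)
          simp [hbv, hbw]
        · simp [hav, haw])
  intro hcomm
  let word (b : Bool) (x y : H) (hx : x ≠ 1) (hy : y ≠ 1) : CoprodI.Word fun _ : Bool => H :=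
    { toList := [⟨b, x⟩, ⟨!b, y⟩]
      ne_one := by simp [hx, hy]
      chain_ne := by simp }
  have h1 : (word true h k hh hk).prod = (word false k h hk hh).prod := by
    simpa [f, word, CoprodI.Word.prod, hne.symm] using congrArg f hcomm
  have h2 := congrArg CoprodI.Word.toList (CoprodI.Word.equiv.symm.injective
    (a₁ := word true h k hh hk) (a₂ := word false k h hk hh) h1)
  simp [word] at h2

end

end GraphProduct

/-! ### The wreath product of a LEF group is LEF only if the data are -/

theorem GraphWreathProduct.inr_mul_inl_of_mul_inv {Γ : Type u} {H : Type v} [Group Γ] [Group H]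
    {V : Type w} {X : SimpleGraph V} (α : Γ →* (X ≃g X)) (g : Γ) (x : V) (h : H) :
    (SemidirectProduct.inr g * SemidirectProduct.inl (of (H := fun _ : V => H) X x h) *
      SemidirectProduct.inr g⁻¹ : GraphWreathProduct H α) =
      SemidirectProduct.inl (of (H := fun _ : V => H) X (α g x) h) := by
  rw [← SemidirectProduct.inl_aut, MonoidHom.comp_apply, autAction_of]

/-- The graph on a group with adjacency being commutation of distinct elements. -/
def commutingGraph (Q : Type u) [Group Q] : SimpleGraph Q where
  Adj a b := a ≠ b ∧ Commute a b
  symm := ⟨fun _ _ h => ⟨h.1.symm, h.2.symm⟩⟩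
  loopless := ⟨fun _ h => h.1 rfl⟩

/-- The action of a group on its commuting graph by conjugation. -/
def commutingGraphConj (Q : Type u) [Group Q] : Q →* (commutingGraph Q ≃g commutingGraph Q) where
  toFun q :=
    { toEquiv := (MulAut.conj q).toEquiv
      map_rel_iff' := by
        intro a b
        simp [commutingGraph, Commute, SemiconjBy] }
  map_one' := by ext; simp
  map_mul' a b := by
    ext x
    change MulAut.conj (a * b) x = MulAut.conj a (MulAut.conj b x)
    simp

theorem IsLEF.isLEFGraphAction {Γ : Type u} {H : Type v} [Group Γ] [Group H] [Nontrivial H]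
    {V : Type w} {X : SimpleGraph V} {α : Γ →* (X ≃g X)}
    (hW : IsLEF (GraphWreathProduct H α)) : IsLEFGraphAction α := by
  classical
  obtain ⟨h, hh⟩ := exists_ne (1 : H)
  intro F Z
  let i : Γ → GraphWreathProduct H α := SemidirectProduct.inr
  let j : V → GraphWreathProduct H α := fun x =>
    SemidirectProduct.inl (of (H := fun _ : V => H) X x h)
  have hj : Function.Injective j := by
    intro x y hxy
    have hxy : of (H := fun _ : V => H) X x h = of (H := fun _ : V => H) X y h :=
      SemidirectProduct.inl_injective hxy
    by_contra hne
    exact of_ne_of hne hh hxy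
  have hcomm (x y : V) (hne : x ≠ y) : X.Adj x y ↔ j x * j y = j y * j x := by
    simp only [j, ← map_mul]
    rw [SemidirectProduct.inl_inj]
    exact ⟨fun hadj => of_commute (H := fun _ : V => H) hadj h h,
      fun hc => by_contra fun hadj => not_commute_of hne hadj hh hh hc⟩
  have hconj (g : Γ) (x : V) : i g * j x = j (α g x) * i g := by
    have := GraphWreathProduct.inr_mul_inl_of_mul_inv (H := H) α g x h
    simp only [map_inv] at this
    exact mul_inv_eq_iff_eq_mul.1 this
  let B : Finset (GraphWreathProduct H α) := F.image i ∪ Z.image j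
  -- Injectivity on `B * B` is what reflects commutation: non-adjacent vertices must go to
  -- non-commuting elements. The relation `hconj`, written without inverses, also involves only
  -- products of two elements of `B`.
  obtain ⟨Q, _, _, φ, hφ, hinj⟩ := hW (B ∪ B * B)
  have hB : B ⊆ B ∪ B * B := Finset.subset_union_left
  have hi {g : Γ} (hg : g ∈ F) : i g ∈ B :=
    Finset.mem_union_left _ (Finset.mem_image_of_mem i hg)
  have hjB {x : V} (hx : x ∈ Z) : j x ∈ B :=
    Finset.mem_union_right _ (Finset.mem_image_of_mem j hx)
  have hmul {a b} (ha : a ∈ B) (hb : b ∈ B) : φ (a * b) = φ a * φ b :=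
    hφ a (hB ha) b (hB hb) (Finset.mem_union_right _ (Finset.mul_mem_mul ha hb))
  refine ⟨Q, inferInstance, inferInstance, Q, inferInstance, commutingGraph Q,
    commutingGraphConj Q, φ ∘ i,
    ⟨⟨fun x => φ (j x.1), fun x y hxy => ?_⟩, ?_⟩, ?_, ?_⟩
  · exact Subtype.ext (hj (hinj (hB (hjB x.2)) (hB (hjB y.2)) hxy))
  · intro x y
    have hinj' : φ (j x) = φ (j y) ↔ x = y :=
      ⟨fun hxy => Subtype.ext (hj (hinj (hB (hjB x.2)) (hB (hjB y.2)) hxy)), fun hxy => by rw [hxy]⟩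
    change φ (j x) ≠ φ (j y) ∧ φ (j x) * φ (j y) = φ (j y) * φ (j x) ↔ X.Adj x y
    rw [Ne, hinj']
    by_cases hxy : x = y
    · simp [hxy]
    · rw [hcomm _ _ fun h => hxy (Subtype.ext h), ← hmul (hjB x.2) (hjB y.2),
        ← hmul (hjB y.2) (hjB x.2), hinj.eq_iff]
      · simp [hxy]
      · exact Finset.mem_union_right _ (Finset.mul_mem_mul (hjB x.2) (hjB y.2))
      · exact Finset.mem_union_right _ (Finset.mul_mem_mul (hjB y.2) (hjB x.2))
  · intro g hg g' hg' hgg'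
    have e : i (g * g') = i g * i g' := map_mul SemidirectProduct.inr g g'
    simp only [Function.comp_apply]
    rw [e, hmul (hi hg) (hi hg')]
  · intro g hg x hx hgx
    change φ (j (α g x)) = φ (i g) * φ (j x) * (φ (i g))⁻¹
    rw [eq_mul_inv_iff_mul_eq, ← hmul (hjB hgx) (hi hg), ← hmul (hi hg) (hjB hx), hconj]

/-! ### LEF wreath products -/

/-- An embedding in `Y` of the subgraph of `X` induced on a finite set `Z` extends to a homomorphism
of graph products that is injective on the subgroup supported on `Z`. -/
theorem GraphProduct.exists_hom_of_embedding (H : Type v) [Group H] {V : Type w}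
    {X : SimpleGraph V} (Z : Finset V) {W : Type*} {Y : SimpleGraph W}
    (π : X.induce (Z : Set V) ↪g Y) :
    ∃ Ψ : GraphProduct (fun _ : V => H) X →* GraphProduct (fun _ : W => H) Y,
      (∀ (v : V) (hv : v ∈ Z) (h : H), Ψ (of (H := fun _ : V => H) X v h) =
        of (H := fun _ : W => H) Y (π ⟨v, hv⟩) h) ∧
      Set.InjOn Ψ (supported (fun _ : V => H) X (Z : Set V)) := by
  classical
  let f : V → Option W := fun v => if hv : v ∈ Z then some (π ⟨v, hv⟩) else none
  have hf : ∀ v v' w w', f v = some w → f v' = some w' → X.Adj v v' → Y.Adj w w' := by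
    intro v v' w w' hv hv' hadj
    simp only [f, Option.dite_none_right_eq_some, Option.some.injEq] at hv hv'
    obtain ⟨hv, rfl⟩ := hv
    obtain ⟨hv', rfl⟩ := hv'
    exact π.map_adj_iff.2 hadj
  -- As `π` also reflects adjacency, its partial inverse induces a homomorphism too, which undoes
  -- the first one on the supported subgroup.
  let g : W → Option V := fun w => if hw : ∃ z, π z = w then some hw.choose.1 else none
  have hgπ (z) : g (π z) = some z.1 := by
    have hz : ∃ z', π z' = π z := ⟨z, rfl⟩
    simp only [g, dif_pos hz, Option.some.injEq]
    rw [π.injective hz.choose_spec]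
  have hg : ∀ w w' v v', g w = some v → g w' = some v' → Y.Adj w w' → X.Adj v v' := by
    intro w w' v v' hw hw' hadj
    simp only [g, Option.dite_none_right_eq_some, Option.some.injEq] at hw hw'
    obtain ⟨hw, rfl⟩ := hw
    obtain ⟨hw', rfl⟩ := hw'
    have : Y.Adj (π hw.choose) (π hw'.choose) := by
      rwa [hw.choose_spec, hw'.choose_spec]
    exact π.map_adj_iff.1 this
  have hΨ (v : V) (hv : v ∈ Z) (h : H) : partialMap H f hf (of (H := fun _ : V => H) X v h) =
      of (H := fun _ : W => H) Y (π ⟨v, hv⟩) h :=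
    partialMap_of_some hf (by simp [f, hv]) h
  refine ⟨partialMap H f hf, hΨ, Set.LeftInvOn.injOn (f₁' := partialMap H g hg) fun x hx => ?_⟩
  refine eq_of_mem_supported (f := (partialMap H g hg).comp (partialMap H f hf))
    (g := MonoidHom.id _) (fun v hv h => ?_) hx
  rw [MonoidHom.comp_apply, hΨ v hv, partialMap_of_some hg (hgπ ⟨v, hv⟩), MonoidHom.id_apply]

/-- A criterion for wreath products to be LEF, in terms of finite approximations of the action
on a graph by actions on finite graphs `Y` for which the graph product over `Y` is LEF. -/
theorem IsLEF.graphWreathProduct_of_exists {Γ : Type u} {H : Type v} [Group Γ] [Group H]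
    {V : Type w} {X : SimpleGraph V} {α : Γ →* (X ≃g X)} (hΓ : IsLEF Γ)
    (hα : ∀ (F : Finset Γ) (Z : Finset V),
      ∃ (Q : Type) (_ : Group Q) (_ : Finite Q) (W : Type) (Y : SimpleGraph W)
        (β : Q →* (Y ≃g Y)) (ρ : Γ → Q) (π : X.induce (Z : Set V) ↪g Y),
        IsLEF (GraphProduct (fun _ : W => H) Y) ∧ IsPartialHomOn F ρ ∧
        ∀ g ∈ F, ∀ (x : V) (hx : x ∈ Z) (hgx : α g x ∈ Z),
          π ⟨α g x, hgx⟩ = β (ρ g) (π ⟨x, hx⟩)) :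
    IsLEF (GraphWreathProduct H α) := by
  classical
  refine IsLEF.of_exists fun A => ?_
  choose S hS using fun a : GraphWreathProduct H α => exists_finset_mem_supported a.left
  let Z₀ : Finset V := A.biUnion S
  let F : Finset Γ := A.image SemidirectProduct.right
  -- The translates are included so that equivariance of `π` applies to every `g ∈ F` and every
  -- vertex of `Z₀`.
  let Z : Finset V := Z₀ ∪ F.biUnion fun g => Z₀.image (α g)
  have hZ₀ {v} (hv : v ∈ Z₀) : v ∈ Z := Finset.mem_union_left _ hv
  have hFZ₀ {g} (hg : g ∈ F) {v} (hv : v ∈ Z₀) : α g v ∈ Z :=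
    Finset.mem_union_right _ (Finset.mem_biUnion.2 ⟨g, hg, Finset.mem_image_of_mem _ hv⟩)
  have hF {a} (ha : a ∈ A) : a.right ∈ F := Finset.mem_image_of_mem _ ha
  have hA {a} (ha : a ∈ A) : a.left ∈ supported (fun _ : V => H) X (Z₀ : Set V) :=
    supported_mono (Finset.coe_subset.2 (Finset.subset_biUnion_of_mem S ha)) (hS a)
  obtain ⟨Q, _, _, W, Y, β, ρ, π, hY, hρ, hβ⟩ := hα F Z
  -- `ρ` need not be injective on `F`; the extra factor `Q'`, acting trivially on `Y`, separates the
  -- elements of `F`.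
  obtain ⟨Q', _, _, φ, hφ, hφinj⟩ := hΓ F
  obtain ⟨Ψ, hΨ, hΨinj⟩ := exists_hom_of_embedding H Z π
  refine ⟨GraphProduct (fun _ : W => H) Y ⋊[(autAction H Y).comp (β.comp (MonoidHom.fst Q Q'))]
    (Q × Q'), inferInstance, fun a => ⟨Ψ a.left, (ρ a.right, φ a.right)⟩,
    hY.semidirectProduct _, fun a ha b hb hab => ?_, fun a ha b hb hab => ?_⟩
  · refine SemidirectProduct.ext ?_ (Prod.ext (hρ _ (hF ha) _ (hF hb) (hF hab))
      (hφ _ (hF ha) _ (hF hb) (hF hab)))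
    simp only [SemidirectProduct.mul_left, map_mul]
    congr 1
    refine eq_of_mem_supported (Z := (Z₀ : Set V))
      (f := Ψ.comp (autAction H X (α a.right)).toMonoidHom)
      (g := (autAction H Y (β (ρ a.right))).toMonoidHom.comp Ψ) (fun v hv h => ?_) (hA hb)
    have hv : v ∈ Z₀ := hv
    change Ψ (autAction H X (α a.right) (of (H := fun _ : V => H) X v h)) =
      autAction H Y (β (ρ a.right)) (Ψ (of (H := fun _ : V => H) X v h))
    rw [autAction_of, hΨ _ (hFZ₀ (hF ha) hv), hΨ _ (hZ₀ hv), autAction_of,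
      hβ _ (hF ha) _ (hZ₀ hv) (hFZ₀ (hF ha) hv)]
  · have h1 : Ψ a.left = Ψ b.left := congrArg SemidirectProduct.left hab
    have h2 : φ a.right = φ b.right := congrArg (fun x => x.right.2) hab
    have hsub : supported (fun _ : V => H) X (Z₀ : Set V) ≤ supported _ X (Z : Set V) :=
      supported_mono fun v hv => hZ₀ hv
    exact SemidirectProduct.ext (hΨinj (hsub (hA ha)) (hsub (hA hb)) h1) (hφinj (hF ha) (hF hb) h2)

/-! ### Graph products of LEF groups over finite graphs -/

theorem IsLEF.graphProduct_bot {H : Type v} [Group H] (hH : IsLEF H) (W : Type u) [Finite W] :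
    IsLEF (GraphProduct (fun _ : W => H) ⊥) := by
  let f : GraphProduct (fun _ : W => H) ⊥ →* CoprodI fun _ : W => H :=
    GraphProduct.lift (fun w => CoprodI.of (M := fun _ : W => H) (i := w)) fun _ _ h => h.elim
  let g : (CoprodI fun _ : W => H) →* GraphProduct (fun _ : W => H) ⊥ := QuotientGroup.mk' _
  have hgf : g.comp f = MonoidHom.id _ := GraphProduct.hom_ext fun w h => by
    rw [MonoidHom.comp_apply, GraphProduct.lift_of]
    rfl
  exact (IsLEF.coprodI hH).of_injective f
    (Function.LeftInverse.injective (g := g) fun x => DFunLike.congr_fun hgf x)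

/-- Permutations are automorphisms of the edgeless graph. -/
def permIsoBot (W : Type u) : Equiv.Perm W →* ((⊥ : SimpleGraph W) ≃g (⊥ : SimpleGraph W)) where
  toFun σ := ⟨σ, by simp⟩
  map_one' := rfl
  map_mul' _ _ := rfl

/-- The action of `Q × Q` on `Q` by left and right multiplication. -/
def mulLeftRight (Q : Type u) [Group Q] : Q × Q →* Equiv.Perm Q where
  toFun a := (Equiv.mulLeft a.1).trans (Equiv.mulRight a.2⁻¹)
  map_one' := by ext; simp
  map_mul' a b := by ext; simp [mul_assoc]

/-- For an endomorphism `r` of `G`, the action of `G` on the edgeless graph with vertex set `G`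
where `g` acts by `x ↦ g * x * (r g)⁻¹`. -/
def twistedMul {G : Type u} [Group G] (r : G →* G) :
    G →* ((⊥ : SimpleGraph G) ≃g (⊥ : SimpleGraph G)) :=
  (permIsoBot G).comp ((mulLeftRight G).comp ((MonoidHom.id G).prod r))

@[simp]
theorem twistedMul_apply {G : Type u} [Group G] (r : G →* G) (g x : G) :
    twistedMul r g x = g * x * (r g)⁻¹ := rfl

/-- One approximation `φ : G → Q` serves both as the embedding of vertices and, through `g ↦ (φ g, φ
(r g))`, as the approximation of the acting group. -/
theorem IsLEF.graphWreathProduct_twistedMul {G : Type u} {H : Type v} [Group G] [Group H]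
    (hG : IsLEF G) (hH : IsLEF H) (r : G →* G) : IsLEF (GraphWreathProduct H (twistedMul r)) := by
  classical
  refine hG.graphWreathProduct_of_exists fun F Z => ?_
  -- `F * Z` holds the intermediate product `g * x`, which equals `(g * x * (r g)⁻¹) * r g`.
  obtain ⟨Q, _, _, φ, hφ, hinj⟩ := hG (F ∪ F.image r ∪ Z ∪ F * Z)
  refine ⟨Q × Q, inferInstance, inferInstance, Q, ⊥, (permIsoBot Q).comp (mulLeftRight Q),
    fun g => (φ g, φ (r g)),
    ⟨⟨fun x => φ x.1, fun x y hxy => Subtype.ext (hinj ?_ ?_ hxy)⟩, ?_⟩,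
    hH.graphProduct_bot Q, fun g hg h hh hgh => Prod.ext ?_ ?_, fun g hg x hx hgx => ?_⟩
  · simp
  · simp
  · simp
  · exact hφ g (by simp [hg]) h (by simp [hh]) (by simp [hgh])
  · have hr {g} (hg : g ∈ F) : r g ∈ F ∪ F.image r ∪ Z ∪ F * Z := by
      simp only [Finset.mem_union]
      exact Or.inl (Or.inl (Or.inr (Finset.mem_image_of_mem r hg)))
    have := hφ _ (hr hg) _ (hr hh)
    rw [← map_mul] at this
    simpa using this (hr hgh)
  · change φ (g * x * (r g)⁻¹) = φ g * φ x * (φ (r g))⁻¹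
    have hgx : g * x * (r g)⁻¹ ∈ Z := hgx
    have hr : r g ∈ F.image r := Finset.mem_image_of_mem r hg
    have hm : g * x ∈ F * Z := Finset.mul_mem_mul hg hx
    rw [eq_mul_inv_iff_mul_eq, ← hφ g (by simp [hg]) x (by simp [hx]), ← hφ, inv_mul_cancel_right]
    · simp [hgx]
    · simp only [Finset.mem_union, hr, true_or, or_true]
    · simp only [inv_mul_cancel_right, Finset.mem_union, hm, or_true]
    · simp only [Finset.mem_union, hm, or_true]

/-- The graph product over `Y` embeds into a wreath product of the graph product over the
complement of a vertex `v` with an edgeless graph. -/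
theorem GraphProduct.exists_injective_hom_twistedMul (H : Type v) [Group H] {W : Type u}
    (Y : SimpleGraph W) (v : W) :
    ∃ (r : GraphProduct (fun _ : ({v}ᶜ : Set W) => H) (Y.induce {v}ᶜ) →*
        GraphProduct (fun _ : ({v}ᶜ : Set W) => H) (Y.induce {v}ᶜ))
      (f : GraphProduct (fun _ : W => H) Y →* GraphWreathProduct H (twistedMul r)),
      Function.Injective f := by
  classical
  let G := GraphProduct (fun _ : ({v}ᶜ : Set W) => H) (Y.induce {v}ᶜ)
  let ofG (u : ({v}ᶜ : Set W)) : H →* G :=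
    of (H := fun _ : ({v}ᶜ : Set W) => H) (Y.induce {v}ᶜ) u
  let ofY (u : W) : H →* GraphProduct (fun _ : W => H) Y := of (H := fun _ : W => H) Y u
  have ofY_comm {a b : W} (hab : Y.Adj a b) (h k : H) : ofY a h * ofY b k = ofY b k * ofY a h :=
    of_commute (H := fun _ : W => H) hab h k
  -- With this retraction, the vertex groups at neighbours of `v` fix the vertex `1` of the twisted
  -- action. So the copy of `H` at `1` commutes with them and can play the role of the vertex group
  -- at `v`.
  let r : G →* G := GraphProduct.lift (fun u => if Y.Adj v u then ofG u else 1) (by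
    intro a b hab h k
    have : ofG a h * ofG b k = ofG b k * ofG a h :=
      of_commute (H := fun _ : ({v}ᶜ : Set W) => H) hab h k
    split_ifs <;> simp [this])
  have hr (u) (h : H) : r (ofG u h) = if Y.Adj v u then ofG u h else 1 := by
    refine (GraphProduct.lift_of (H := fun _ : ({v}ᶜ : Set W) => H) _ _ u h).trans ?_
    split_ifs <;> rfl
  let ofB (x : G) : H →* GraphProduct (fun _ : G => H) ⊥ := of (H := fun _ : G => H) ⊥ x
  let iB : GraphProduct (fun _ : G => H) ⊥ →* GraphWreathProduct H (twistedMul r) :=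
    SemidirectProduct.inl
  let iG : G →* GraphWreathProduct H (twistedMul r) := SemidirectProduct.inr
  have hcomm (u : ({v}ᶜ : Set W)) (hu : Y.Adj v u) (h k : H) :
      iB (ofB 1 h) * iG (ofG u k) = iG (ofG u k) * iB (ofB 1 h) := by
    have h1 := GraphWreathProduct.inr_mul_inl_of_mul_inv (H := H) (twistedMul r) (ofG u k) 1 h
    rw [twistedMul_apply, hr, if_pos hu, mul_one, mul_inv_cancel, map_inv] at h1
    exact (mul_inv_eq_iff_eq_mul.1 h1).symm
  let f : GraphProduct (fun _ : W => H) Y →* GraphWreathProduct H (twistedMul r) :=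
    GraphProduct.lift
      (fun u => if hu : u = v then iB.comp (ofB 1) else iG.comp (ofG ⟨u, hu⟩)) (by
      intro a b hab h k
      by_cases ha : a = v
      · have hb : b ≠ v := fun hb => hab.ne (ha.trans hb.symm)
        simp only [dif_pos ha, dif_neg hb]
        exact hcomm ⟨b, hb⟩ (ha ▸ hab) h k
      · by_cases hb : b = v
        · simp only [dif_neg ha, dif_pos hb]
          exact (hcomm ⟨a, ha⟩ (hb ▸ hab.symm) k h).symm
        · simp only [dif_neg ha, dif_neg hb, MonoidHom.comp_apply, ← map_mul]
          exact congrArg iG (of_commute (H := fun _ : ({v}ᶜ : Set W) => H)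
            (X := Y.induce {v}ᶜ) (v := ⟨a, ha⟩) (w := ⟨b, hb⟩) hab h k))
  let p : G →* GraphProduct (fun _ : W => H) Y := GraphProduct.map H
    (SimpleGraph.Embedding.induce ({v}ᶜ : Set W)).toHom
  have hp (u) (h : H) : p (ofG u h) = ofY u h := map_of H _ u h
  have hpr (g : G) (h : H) : p (r g) * ofY v h = ofY v h * p (r g) := by
    have : (MulAut.conj (ofY v h)).toMonoidHom.comp (p.comp r) = p.comp r := by
      refine GraphProduct.hom_ext fun u k => ?_
      change ofY v h * p (r (ofG u k)) * (ofY v h)⁻¹ = p (r (ofG u k))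
      rw [hr]
      split_ifs with hu
      · rw [hp, ofY_comm hu, mul_inv_cancel_right]
      · simp
    exact (mul_inv_eq_iff_eq_mul.1 (DFunLike.congr_fun this g)).symm
  -- The left inverse of `f` sends the copy of `H` at `x` to the conjugate by `p x` of the vertex
  -- group at `v`.
  let q : GraphProduct (fun _ : G => H) ⊥ →* GraphProduct (fun _ : W => H) Y :=
    GraphProduct.lift (fun x => (MulAut.conj (p x)).toMonoidHom.comp (ofY v)) fun _ _ h => h.elim
  have hq (x : G) (h : H) : q (ofB x h) = p x * ofY v h * (p x)⁻¹ :=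
    GraphProduct.lift_of (H := fun _ : G => H) _ _ x h
  let l : GraphWreathProduct H (twistedMul r) →* GraphProduct (fun _ : W => H) Y :=
    SemidirectProduct.lift q p (by
      intro g
      refine GraphProduct.hom_ext fun x h => ?_
      change q (autAction H ⊥ (twistedMul r g) (ofB x h)) = p g * q (ofB x h) * (p g)⁻¹
      have e : autAction H ⊥ (twistedMul r g) (ofB x h) = ofB (g * x * (r g)⁻¹) h :=
        autAction_of H _ _ x h
      -- The twist by `(r g)⁻¹` disappears after conjugation, since `p (r g)` centralizes the vertex
      -- group at `v`.
      have e2 : (p (r g))⁻¹ * ofY v h * p (r g) = ofY v h := by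
        rw [mul_assoc, ← hpr, inv_mul_cancel_left]
      rw [e, hq, hq]
      simp only [map_mul, map_inv, mul_inv_rev, inv_inv]
      calc _ = p g * p x * ((p (r g))⁻¹ * ofY v h * p (r g)) * (p x)⁻¹ * (p g)⁻¹ := by group
        _ = _ := by rw [e2]; group)
  refine ⟨r, f, Function.LeftInverse.injective (g := l) fun x => ?_⟩
  have : l.comp f = MonoidHom.id _ := by
    refine GraphProduct.hom_ext fun u h => ?_
    rw [MonoidHom.comp_apply, MonoidHom.id_apply, GraphProduct.lift_of]
    split_ifs with hu
    · subst hu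
      change l (iB (ofB 1 h)) = _
      simp only [l, iB, SemidirectProduct.lift_inl, hq, map_one, one_mul, inv_one, mul_one]
      rfl
    · change l (iG (ofG ⟨u, hu⟩ h)) = _
      simp only [l, iG, SemidirectProduct.lift_inr, hp]
      rfl
  exact DFunLike.congr_fun this x

theorem IsLEF.graphProduct {H : Type v} [Group H] (hH : IsLEF H) {W : Type u} [Finite W]
    (Y : SimpleGraph W) : IsLEF (GraphProduct (fun _ : W => H) Y) := by
  classical
  induction hn : Nat.card W generalizing W with
  | zero =>
    have : IsEmpty W := Finite.card_eq_zero_iff.1 hn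
    rw [Subsingleton.elim Y ⊥]
    exact hH.graphProduct_bot W
  | succ n ih =>
    have : Nonempty W := Finite.card_pos_iff.1 (by lia)
    obtain ⟨v⟩ := this
    obtain ⟨r, f, hf⟩ := GraphProduct.exists_injective_hom_twistedMul H Y v
    refine ((ih (Y.induce {v}ᶜ) ?_).graphWreathProduct_twistedMul hH r).of_injective f hf
    rw [Nat.card_coe_set_eq, Set.ncard_compl, Set.ncard_singleton, hn]
    rfl

theorem IsLEF.graphWreathProduct {Γ : Type u} {H : Type v} [Group Γ] [Group H] {V : Type w}
    {X : SimpleGraph V} {α : Γ →* (X ≃g X)} (hΓ : IsLEF Γ) (hH : IsLEF H)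
    (hα : IsLEFGraphAction α) : IsLEF (GraphWreathProduct H α) := by
  refine hΓ.graphWreathProduct_of_exists fun F Z => ?_
  obtain ⟨Q, hQ, hQfin, W, _, Y, β, ρ, π, hρ, hπ⟩ := hα F Z
  exact ⟨Q, hQ, hQfin, W, Y, β, ρ, π, hH.graphProduct Y, hρ, hπ⟩

theorem mainTheorem9 (Γ : Type u) (H : Type v) [Group Γ] [Group H] [Nontrivial H]
    {V : Type w} [Nonempty V] (X : SimpleGraph V) (α : Γ →* (X ≃g X)) :
    IsLEF (GraphWreathProduct H α) ↔ IsLEF Γ ∧ IsLEF H ∧ IsLEFGraphAction α := by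
  refine ⟨fun hW => ⟨?_, ?_, hW.isLEFGraphAction⟩, fun h => h.1.graphWreathProduct h.2.1 h.2.2⟩
  · exact hW.of_injective SemidirectProduct.inr SemidirectProduct.inr_injective
  · obtain ⟨v⟩ := ‹Nonempty V›
    exact hW.of_injective (SemidirectProduct.inl.comp (of (H := fun _ : V => H) X v))
      (SemidirectProduct.inl_injective.comp (of_injective v))
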